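/- A cotree of a finite simple graph $G$ is a finite rooted tree whose leaves are in bijection with the vertices of $G$, in which every interior (non-leaf) vertex has at least two immediate successors and carries one of the two types $\cup$ (union) and $\otimes$ (join), adjacent interior vertices have different types, and two distinct vertices of $G$ are adjacent if and only if the least common ancestor of the corresponding leaves is of type $\otimes$. Let $G$ be a connected cograph (a graph without an induced path on four vertices) on $n \ge 2$ vertices, and let $T_G$ be its cotree, with interior vertices $w_1, \dots, w_r$, where $w_1$ is the root. For each $i$, let $s_i$ be the number of immediate successors of $w_i$ that are interior vertices and $t_i$ the number of immediate successors of $w_i$ that are leaves, and let the degree of $w_j$ be $$\delta(w_j) = \sum_{i \,:\, \operatorname{lca}(w_i, w_j) \text{ is of type } \otimes} t_i ,$$ where $\operatorname{lca}$ is the least common ancestor in $T_G$ (with $\operatorname{lca}(w_j,w_j)=w_j$, so that $i=j$ is included when $w_j$ is of type $\otimes$). Then the number of spanning trees of $G$ equals $$\prod_{i=2}^{r} \delta(w_i)^{\,s_i+t_i-1} \cdot n^{\,s_1+t_1-2}.$$ -/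

import Mathlib

/-- A cograph: no four vertices induce a path `P₄`. -/
def SimpleGraph.IsCograph {V : Type*} (G : SimpleGraph V) : Prop :=
  ¬ (SimpleGraph.pathGraph 4).IsIndContained G

/-- The number of spanning trees of `G`. -/
noncomputable def SimpleGraph.numSpanningTrees {V : Type*} (G : SimpleGraph V) : ℕ :=
  Set.ncard {H : SimpleGraph V | H ≤ G ∧ H.IsTree}

/-- The two types of interior vertices of a cotree. -/
inductive CotreeKind where
  | union
  | join

/-- `T : Cotree G` says that `T` is a cotree of `G`.  In Mathlib's `RootedTree` the root is `⊥`,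
`x ≤ y` means that `x` is an ancestor of `y` (or `y` itself), `x ⋖ y` means that `y` is an
immediate successor (child) of `x`, `x ⊓ y` is the least common ancestor of `x` and `y`, and the
leaves are the maximal elements. -/
structure Cotree.{u, v} {V : Type u} (G : SimpleGraph V) where
  /-- the underlying rooted tree -/
  tree : RootedTree.{v}
  [fintype : Fintype tree]
  /-- the leaves represent the vertices of `G` -/
  leaf : V ≃ {x : tree // IsMax x}
  /-- the type of an interior vertex; the value at a leaf carries no meaning and is never used -/
  kind : tree → CotreeKind
  /-- every interior vertex has at least two immediate successors -/
  two_children : ∀ w : tree, ¬ IsMax w → ∃ x y : tree, x ≠ y ∧ w ⋖ x ∧ w ⋖ y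
  /-- the types alternate along the edges between interior vertices -/
  alternate : ∀ w x : tree, ¬ IsMax x → w ⋖ x → kind w ≠ kind x
  /-- two vertices are adjacent iff their least common ancestor is of type join -/
  adj_iff : ∀ u v : V, u ≠ v →
    (G.Adj u v ↔ kind ((leaf u : tree) ⊓ (leaf v : tree)) = CotreeKind.join)

namespace Cotree

attribute [instance] Cotree.fintype

variable {V : Type*} {G : SimpleGraph V} (T : Cotree G)

/-- The root of the cotree. -/
def root : T.tree := ⊥

open Classical in
/-- The set of interior vertices (the vertices that are not leaves). -/
noncomputable def interior : Finset T.tree :=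
  Finset.univ.filter fun w => ¬ IsMax w

open Classical in
/-- `s w`: the number of immediate successors of `w` that are interior vertices. -/
noncomputable def s (w : T.tree) : ℕ :=
  (Finset.univ.filter fun x : T.tree => w ⋖ x ∧ ¬ IsMax x).card

open Classical in
/-- `t w`: the number of immediate successors of `w` that are leaves. -/
noncomputable def t (w : T.tree) : ℕ :=
  (Finset.univ.filter fun x : T.tree => w ⋖ x ∧ IsMax x).card

open Classical in
/-- The degree of an interior vertex `w`: the number of leaves, each of weight one, whose parent `x`
has with `w` a least common ancestor of type join (`x = w` is allowed). -/
noncomputable def degree (w : T.tree) : ℕ :=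
  ∑ x ∈ T.interior.filter (fun x => T.kind (x ⊓ w) = CotreeKind.join), T.t x

end Cotree

/-! By the matrix tree theorem, `det (L + J) = n² τ(G)`, with `L` the Laplacian, `J` the all-ones
matrix and `τ(G)` the number of spanning trees. The left side is computed up the cotree
(`det_lapMatrix_submatrix_add_const`). Restrict `L` to the leaves below a node `w` and add a
constant `y` to every entry. For interior `w` and `y = 1` or `0`, according as `w` is a join or not,
entries between different children vanish and all row sums equal `δ(w)`. Induction gives the block
of each child a factor `δ(w)`; by `Matrix.det_add_const`, passing to any other `y` only trades one
of these factors for `extDegree w + y * size w`. At the root with `y = 1` this is `n`, and `δ` is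
`n` as well. -/

/-! ### Kirchhoff's theorem via parent maps -/

open Finset Matrix in
/-- The determinant of `1 - N` where `N` is the matrix of a self-map `f` fixing `r`, with the row
`r` of `N` removed, tests whether every point reaches `r`. -/
theorem det_parentMatrix {V R : Type*} [Fintype V] [DecidableEq V] [CommRing R] [IsDomain R]
    (r : V) (f : V → V) (hr : f r = r) [Decidable (∀ v, ∃ k, f^[k] v = r)] :
    (Matrix.of fun v => if v = r then Pi.single r (1 : R)
      else Pi.single v 1 - Pi.single (f v) 1 : Matrix V V R).det =
      if ∀ v, ∃ k, f^[k] v = r then 1 else 0 := by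
  classical
  split_ifs with h
  -- Grading by the distance to `r` along `f` makes the transpose block triangular with identity
  -- diagonal blocks.
  · set b : V → ℕ := fun v => Nat.find (h v) with hb
    have hlt : ∀ v, v ≠ r → b (f v) < b v := by
      intro v hv
      have h1 : f^[b v] v = r := Nat.find_spec (h v)
      rcases hbv : b v with _ | k
      · rw [hbv] at h1; exact absurd h1 hv
      · rw [hbv, Function.iterate_succ_apply] at h1
        exact Nat.lt_succ_of_le (Nat.find_min' (h (f v)) h1)
    rw [← Matrix.det_transpose]
    have ht : (Matrix.of fun v => if v = r then Pi.single r (1 : R)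
      else Pi.single v 1 - Pi.single (f v) 1 : Matrix V V R)ᵀ.BlockTriangular b := by
      intro i j hij
      have hne : i ≠ j := by rintro rfl; exact lt_irrefl _ hij
      by_cases hj : j = r
      · subst hj
        simp [hne]
      · have : i ≠ f j := by rintro rfl; exact absurd (hlt j hj) (not_lt.2 hij.le)
        simp [hj, hne, this]
    rw [ht.det]
    refine Finset.prod_eq_one fun a _ => ?_
    refine (congrArg Matrix.det ?_).trans Matrix.det_one
    ext ⟨i, hi⟩ ⟨j, hj⟩
    by_cases hjr : j = r
    · subst hjr
      simp [Matrix.toSquareBlock_def, Matrix.one_apply, Pi.single_apply]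
    · have : i ≠ f j := by rintro rfl; have := hlt j hjr; omega
      simp [Matrix.toSquareBlock_def, hjr, this, Matrix.one_apply, Pi.single_apply]
  · push Not at h
    obtain ⟨v, hv⟩ := h
    rw [← Matrix.exists_mulVec_eq_zero_iff]
    -- The indicator of the points that never reach `r` is constant along `f`, hence in the kernel.
    refine ⟨fun u => if ∀ k, f^[k] u ≠ r then 1 else 0, fun h0 => ?_, ?_⟩
    · have := congrFun h0 v
      simp [hv] at this
    · ext u
      by_cases hu : u = r
      · subst hu
        have : ¬ ∀ k, f^[k] u ≠ u := fun h => h 0 rfl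
        simp [Matrix.mulVec, this]
      · have : (∀ k, f^[k] (f u) ≠ r) ↔ (∀ k, f^[k] u ≠ r) := by
          refine ⟨fun h k => ?_, fun h k => h (k + 1)⟩
          cases k with
          | zero => exact hu
          | succ k => exact h k
        simp only [Matrix.mulVec, Matrix.of_apply, hu, if_false, sub_dotProduct,
          single_one_dotProduct, Pi.zero_apply, sub_eq_zero, this]

namespace SimpleGraph

/-- The graph formed by the edges `v — f v`. -/
def ofParent {V : Type*} (f : V → V) : SimpleGraph V := SimpleGraph.fromRel fun a b => f a = b

theorem ofParent_adj {V : Type*} {f : V → V} {a b : V} :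
    (ofParent f).Adj a b ↔ a ≠ b ∧ (f a = b ∨ f b = a) := Iff.rfl

theorem connected_ofParent {V : Type*} {f : V → V} {r : V} (h : ∀ v, ∃ k, f^[k] v = r) :
    (ofParent f).Connected := by
  have key : ∀ k v, f^[k] v = r → (ofParent f).Reachable v r := by
    intro k
    induction k with
    | zero => rintro v rfl; rfl
    | succ k ih =>
      intro v hv
      refine Reachable.trans ?_ (ih (f v) hv)
      by_cases h : v = f v
      · rw [← h]
      · exact Adj.reachable ⟨h, Or.inl rfl⟩
  have : Nonempty V := ⟨r⟩
  refine ⟨fun u v => ?_⟩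
  obtain ⟨k, hk⟩ := h u
  obtain ⟨l, hl⟩ := h v
  exact (key k u hk).trans (key l v hl).symm

/-- Each edge is `s(v, f v)` with `v ≠ r`, so a connected graph has at most `|V| - 1` edges here. -/
theorem isTree_ofParent {V : Type*} [Finite V] {f : V → V} {r : V} (hr : f r = r)
    (h : ∀ v, ∃ k, f^[k] v = r) : (ofParent f).IsTree := by
  classical
  have := Fintype.ofFinite V
  have hc := connected_ofParent h
  refine isTree_iff_connected_and_card.2 ⟨hc, le_antisymm ?_ hc.card_vert_le_card_edgeSet_add_one⟩
  have hsub : (ofParent f).edgeSet ⊆ ((Finset.univ.erase r).image fun v => s(v, f v) :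
      Finset (Sym2 V)) := by
    intro e
    induction e with
    | h a b =>
    rw [mem_edgeSet, ofParent_adj]
    rintro ⟨hab, rfl | rfl⟩
    · simp only [Finset.coe_image, Set.mem_image]
      exact ⟨a, by simpa using fun h => hab (by rw [h, hr]), rfl⟩
    · simp only [Finset.coe_image, Set.mem_image]
      exact ⟨b, by simpa using fun h => hab (by rw [h, hr]), Sym2.eq_swap⟩
  have h1 := Set.ncard_le_ncard hsub (Finset.finite_toSet _)
  rw [Set.ncard_coe_finset, ← Nat.card_coe_set_eq] at h1
  have h2 := h1.trans Finset.card_image_le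
  rw [Finset.card_erase_of_mem (Finset.mem_univ r), Finset.card_univ] at h2
  have : 0 < Fintype.card V := Fintype.card_pos_iff.2 ⟨r⟩
  rw [Nat.card_eq_fintype_card (α := V)]
  omega

theorem ofParent_injOn {V : Type*} {f g : V → V} {r : V} (hf : f r = r) (hg : g r = r)
    (h : ∀ v, ∃ k, f^[k] v = r) (h' : ∀ v, ∃ k, g^[k] v = r) (hfg : ofParent f = ofParent g) :
    f = g := by
  have hfix : ∀ (f : V → V) (k : ℕ) v, f v = v → f^[k] v = v := fun f k v hv =>
    Function.iterate_fixed hv k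
  have hadj : ∀ v, v ≠ r → v ≠ f v := by
    intro v hv hfv
    obtain ⟨k, hk⟩ := h v
    rw [hfix f k v hfv.symm] at hk
    exact hv hk
  have key : ∀ k v, f^[k] v = r → f v = g v := by
    intro k
    induction k with
    | zero => rintro v rfl; exact hf.trans hg.symm
    | succ k ih =>
      intro v hv
      have h1 := ih (f v) hv
      by_cases hvr : v = r
      · rw [hvr, hf, hg]
      have h2 : (ofParent g).Adj v (f v) := hfg ▸ ⟨hadj v hvr, Or.inl rfl⟩
      rcases h2.2 with h2 | h2
      · exact h2.symm
      -- Otherwise `v` and `f v` form a 2-cycle of `f`, which cannot reach the fixed point `r`.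
      · exfalso
        have h3 : f (f v) = v := h1.trans h2
        have h4 : ∀ j, f^[j] v = v ∨ f^[j] v = f v := by
          intro j
          induction j with
          | zero => exact Or.inl rfl
          | succ j ihj =>
            rw [Function.iterate_succ_apply']
            rcases ihj with e | e <;> rw [e]
            · exact Or.inr rfl
            · exact Or.inl h3
        obtain ⟨j, hj⟩ := h v
        rcases h4 j with e | e
        · exact hvr (e.symm.trans hj)
        · have : f v = r := e.symm.trans hj
          rw [this, hf] at h3
          exact hvr h3.symm
  funext v
  obtain ⟨k, hk⟩ := h v
  exact key k v hk

/-- The parent is a neighbour closer to `r`; equality of graphs follows as a tree is minimal among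
connected graphs. -/
theorem IsTree.exists_ofParent {V : Type*} {H : SimpleGraph V} (hH : H.IsTree) (r : V) :
    ∃ f : V → V, f r = r ∧ (∀ v, v ≠ r → H.Adj v (f v)) ∧ (∀ v, ∃ k, f^[k] v = r) ∧
      ofParent f = H := by
  classical
  have hex : ∀ v, v ≠ r → ∃ u, H.Adj v u ∧ H.dist u r < H.dist v r := by
    intro v hv
    obtain ⟨p, hp⟩ := hH.connected.exists_walk_length_eq_dist v r
    cases p with
    | nil => exact absurd rfl hv
    | cons hadj q =>
      refine ⟨_, hadj, ?_⟩
      have := dist_le q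
      rw [Walk.length_cons] at hp
      omega
  choose! p hp hlt using hex
  refine ⟨fun v => if v = r then r else p v, by simp, fun v hv => by simpa [hv] using hp v hv, ?_⟩
  set f : V → V := fun v => if v = r then r else p v with hf
  have hreach : ∀ v, ∃ k, f^[k] v = r := by
    intro v
    induction hd : H.dist v r using Nat.strong_induction_on generalizing v with
    | _ d ih =>
      by_cases hv : v = r
      · exact ⟨0, hv⟩
      · obtain ⟨k, hk⟩ := ih _ (hd ▸ hlt v hv) (p v) rfl
        exact ⟨k + 1, by simpa [hf, hv] using hk⟩
  refine ⟨hreach, ?_⟩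
  have hle : ofParent f ≤ H := by
    have h1 : ∀ a, a ≠ f a → H.Adj a (f a) := by
      intro a ha
      have har : a ≠ r := by rintro rfl; simp [hf] at ha
      simpa [hf, har] using hp a har
    rintro a b ⟨hab, rfl | rfl⟩
    · exact h1 a hab
    · exact (h1 b hab.symm).symm
  exact le_antisymm hle ((isTree_iff_minimal_connected.1 hH).2 (connected_ofParent hreach) hle)

variable {V : Type*} [Fintype V] [DecidableEq V] (G : SimpleGraph V) [DecidableRel G.Adj]

open Matrix in
/-- **Kirchhoff's matrix tree theorem**. -/
theorem det_updateRow_lapMatrix (R : Type*) [CommRing R] [IsDomain R] (r : V) :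
    ((G.lapMatrix R).updateRow r (Pi.single r 1)).det = G.numSpanningTrees := by
  classical
  -- A Laplacian row is the sum of `e_v - e_u` over the neighbours `u` of `v`. Multilinearity
  -- expands the determinant over choices of a parent for each `v ≠ r`.
  set A : V → Finset V := fun v => if v = r then {r} else G.neighborFinset v with hA
  set g : V → V → V → R := fun v u => if v = r then Pi.single r (1 : R)
      else Pi.single v 1 - Pi.single u 1 with hg
  have hrow : (G.lapMatrix R).updateRow r (Pi.single r 1) = fun v => ∑ u ∈ A v, g v u := by
    funext v
    by_cases hv : v = r
    · subst hv
      simp [hA, hg]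
    · ext u
      rw [Matrix.updateRow_ne hv]
      simp only [hA, hg, hv, if_false, Finset.sum_apply, Pi.sub_apply, Finset.sum_sub_distrib,
        lapMatrix, Matrix.sub_apply, degMatrix, adjMatrix_apply]
      congr 1
      · by_cases huv : u = v
        · subst huv; simp
        · simp [huv, Ne.symm huv]
      · simp [Pi.single_apply]
  have hdet := (Matrix.detRowAlternating (n := V) (R := R)).toMultilinearMap.map_sum_finset g A
  rw [← hrow] at hdet
  change Matrix.det _ = ∑ f ∈ Fintype.piFinset A, Matrix.det _ at hdet
  rw [hdet]
  have hmem : ∀ f, f ∈ Fintype.piFinset A ↔ f r = r ∧ ∀ v, v ≠ r → G.Adj v (f v) := by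
    intro f
    rw [Fintype.mem_piFinset]
    constructor
    · intro h
      refine ⟨by simpa [hA] using h r, fun v hv => by simpa [hA, hv] using h v⟩
    · rintro ⟨h1, h2⟩ v
      by_cases hv : v = r
      · subst hv; simp [hA, h1]
      · simpa [hA, hv] using h2 v hv
  refine (Finset.sum_congr rfl fun f hf =>
    det_parentMatrix (R := R) r f ((hmem f).1 hf).1).trans ?_
  rw [← Finset.sum_filter, Finset.sum_const, nsmul_eq_mul, mul_one]
  congr 1
  rw [numSpanningTrees, ← Set.ncard_coe_finset]
  refine Set.ncard_congr (fun f _ => ofParent f) ?_ ?_ ?_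
  · intro f hf
    rw [Finset.mem_coe, Finset.mem_filter, hmem] at hf
    refine ⟨?_, isTree_ofParent hf.1.1 hf.2⟩
    have h1 : ∀ a, a ≠ f a → G.Adj a (f a) := fun a ha =>
      hf.1.2 a (by rintro rfl; exact ha hf.1.1.symm)
    rintro a b ⟨hab, rfl | rfl⟩
    · exact h1 a hab
    · exact (h1 b hab.symm).symm
  · intro f f' hf hf' h
    rw [Finset.mem_coe, Finset.mem_filter, hmem] at hf hf'
    exact ofParent_injOn hf.1.1 hf'.1.1 hf.2 hf'.2 h
  · rintro H ⟨hle, hH⟩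
    obtain ⟨f, h1, h2, h3, h4⟩ := hH.exists_ofParent r
    refine ⟨f, ?_, h4⟩
    rw [Finset.mem_coe, Finset.mem_filter, hmem]
    exact ⟨⟨h1, fun v hv => hle (h2 v hv)⟩, h3⟩

open Matrix in
/-- The matrix tree theorem, for the sum of the Laplacian and the all-ones matrix. -/
theorem det_lapMatrix_add_one (R : Type*) [CommRing R] [IsDomain R] [Nonempty V] :
    (G.lapMatrix R + Matrix.of fun _ _ => 1).det =
      (Fintype.card V : R) ^ 2 * G.numSpanningTrees := by
  obtain ⟨r⟩ := ‹Nonempty V›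
  set n : R := (Fintype.card V : R) with hn
  have hrow : ∀ v, ∑ u, G.lapMatrix R v u = 0 := fun v => by
    simpa [Matrix.mulVec, dotProduct] using congrFun (G.lapMatrix_mulVec_const_eq_zero (R := R)) v
  have hcol : ∀ u, ∑ v, G.lapMatrix R v u = 0 := fun u => by
    rw [← hrow u]
    exact Finset.sum_congr rfl fun v _ => (G.isSymm_lapMatrix R).apply u v
  set B : Matrix V V R := G.lapMatrix R + Matrix.of fun _ _ => 1 with hB
  -- Replacing row `r` by the sum of all rows extracts one factor `n`; the same move on columns
  -- below extracts the other.
  have h1 := Matrix.det_updateRow_sum B r 1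
  have h2 : (∑ k, (1 : V → R) k • B k) = n • (fun _ => 1) := by
    funext u
    refine (Finset.sum_apply u _ _).trans ?_
    simp [hB, Finset.sum_add_distrib, hcol, hn]
  rw [h2, Matrix.det_updateRow_smul, Pi.one_apply, one_smul] at h1
  have h3 : (B.updateRow r (fun _ => (1 : R))).det =
      ((G.lapMatrix R).updateRow r (fun _ => (1 : R))).det := by
    refine Matrix.det_eq_of_forall_row_eq_smul_add_const (fun v => if v = r then 0 else 1) r
      (by simp) fun i j => ?_
    by_cases hi : i = r
    · subst hi; simp
    · simp [hB, hi]
  set A := (G.lapMatrix R).updateRow r (fun _ => (1 : R)) with hA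
  have h4 := Matrix.det_updateCol_sum A r 1
  have h5 : (fun k => ∑ i, (1 : V → R) i • A k i) = n • Pi.single r (1 : R) := by
    funext v
    by_cases hv : v = r
    · subst hv; simp [hA, hn]
    · simp [hA, hv, hrow]
  rw [h5, Matrix.det_updateCol_smul, Pi.one_apply, one_smul] at h4
  have h6 : (A.updateCol r (Pi.single r 1)).det = G.numSpanningTrees := by
    rw [← G.det_updateRow_lapMatrix R r, ← Matrix.det_transpose, ← Matrix.updateRow_transpose,
      ← Matrix.adjugate_apply, ← Matrix.adjugate_transpose, Matrix.transpose_apply,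
      Matrix.adjugate_apply, hA]
    congr 1
    ext i j
    by_cases hi : i = r
    · subst hi; simp
    · simp [hi]
  rw [← h1, h3, ← h4, h6]
  ring

end SimpleGraph

/-! ### Two determinant identities -/

/-- Constant row sums give `N J = δ J`, so the new matrix is `N (1 + (b/δ) J)`, a rank-one
perturbation of the identity times `N`. -/
theorem Matrix.det_add_const {m K : Type*} [Fintype m] [DecidableEq m] [Field K]
    (N : Matrix m m K) {δ : K} (hδ : δ ≠ 0) (hN : ∀ i, ∑ j, N i j = δ) (b : K) :
    (N + Matrix.of fun _ _ => b).det * δ = N.det * (δ + b * Fintype.card m) := by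
  have h : N + Matrix.of (fun _ _ => b) = N * (1 + Matrix.replicateCol Unit (fun _ : m => b / δ) *
      Matrix.replicateRow Unit (fun _ : m => (1 : K))) := by
    ext i j
    rw [Matrix.mul_add, Matrix.mul_one]
    simp only [Matrix.add_apply, Matrix.of_apply, Matrix.mul_apply, Matrix.replicateCol_apply,
      Matrix.replicateRow_apply, Finset.univ_unique, Finset.sum_singleton, mul_one,
      ← Finset.sum_mul, hN]
    field_simp
  rw [h, Matrix.det_mul, Matrix.det_one_add_replicateCol_mul_replicateRow]
  simp only [dotProduct, one_mul, Finset.sum_const, Finset.card_univ, nsmul_eq_mul]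
  field_simp

theorem Matrix.det_eq_prod_toSquareBlock {m α R : Type*} [Fintype m] [DecidableEq m]
    [DecidableEq α] [CommRing R]
    (M : Matrix m m R) (b : m → α) (h : ∀ i j, b i ≠ b j → M i j = 0) :
    M.det = ∏ a ∈ Finset.univ.image b, (M.toSquareBlock b a).det := by
  classical
  let : LinearOrder α := linearOrderOfSTO WellOrderingRel
  have hM : M.BlockTriangular b := fun i j hij => h i j (ne_of_gt hij)
  convert hM.det

/-! ### Least common ancestors -/

namespace RootedTree

variable {t : RootedTree}

/-- The ancestors of `z` form a chain, so `x ⊓ z` is comparable to `c`, and it cannot lie above `c`.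
-/
theorem inf_eq_inf_of_not_le {c x z : t} (hz : c ≤ z) (hx : ¬ c ≤ x) : x ⊓ z = x ⊓ c := by
  refine le_antisymm (le_inf inf_le_left ?_) (inf_le_inf_left x hz)
  rcases le_total_of_directed (inf_le_right : x ⊓ z ≤ z) hz with h | h
  · exact absurd (h.trans inf_le_left) hx
  · exact h

theorem inf_eq_inf_of_covBy {w c x : t} (hc : w ⋖ c) (hx : ¬ c ≤ x) : x ⊓ c = x ⊓ w := by
  refine le_antisymm (le_inf inf_le_left ?_) (inf_le_inf_left x hc.le)
  rcases le_total_of_directed (inf_le_right : x ⊓ c ≤ c) hc.le with h | h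
  · rcases hc.eq_or_eq h inf_le_right with h | h
    · exact h.le
    · exact absurd (inf_eq_right.1 h) hx
  · exact h

theorem eq_of_covBy_of_le {w c c' x : t} (hc : w ⋖ c) (hc' : w ⋖ c') (h : c ≤ x) (h' : c' ≤ x) :
    c = c' := by
  rcases le_total_of_directed h h' with h | h
  · exact ((hc.eq_or_eq hc'.le h).resolve_left hc'.ne').symm
  · exact (hc'.eq_or_eq hc.le h).resolve_left hc.ne'

end RootedTree

/-! ### Leaves, adjacency and degrees in the cotree -/

namespace Cotree

open Classical

variable {V : Type*} {G : SimpleGraph V} (T : Cotree G)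

theorem exists_leaf_ge (w : T.tree) : ∃ v, w ≤ T.leaf v := by
  obtain ⟨m, hwm, hm⟩ := Set.Finite.exists_le_maximal (Set.finite_univ (α := T.tree))
    (Set.mem_univ w)
  have hmax : IsMax m := fun y hy => hm.2 (Set.mem_univ y) hy
  exact ⟨T.leaf.symm ⟨m, hmax⟩, by simpa using hwm⟩

theorem exists_child {w x : T.tree} (h : w < x) : ∃ c, w ⋖ c ∧ c ≤ x :=
  exists_covBy_le_of_lt h

theorem lt_leaf {w : T.tree} (hw : ¬ IsMax w) {v : V} (h : w ≤ T.leaf v) : w < T.leaf v :=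
  lt_of_le_of_ne h fun e => hw (e ▸ (T.leaf v).2)

theorem not_leaf_le {w : T.tree} (hw : ¬ IsMax w) (v : V) : ¬ (T.leaf v : T.tree) ≤ w :=
  fun h => hw (((T.leaf v).2.eq_of_le h) ▸ (T.leaf v).2)

/-- The set of children of `w`. -/
noncomputable def children (w : T.tree) : Finset T.tree := Finset.univ.filter fun c => w ⋖ c

theorem card_children (w : T.tree) : (T.children w).card = T.s w + T.t w := by
  rw [s, t, add_comm, ← Finset.card_filter_add_card_filter_not (s := T.children w) IsMax,
    children, Finset.filter_filter, Finset.filter_filter]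

theorem two_le_card_children {w : T.tree} (hw : ¬ IsMax w) : 2 ≤ (T.children w).card := by
  obtain ⟨x, y, hxy, hx, hy⟩ := T.two_children w hw
  exact Finset.one_lt_card.2 ⟨x, by simpa [children], y, by simpa [children], hxy⟩

theorem adj_iff_of_le {c : T.tree} {u v : V} (hv : c ≤ T.leaf v) (hu : ¬ c ≤ T.leaf u) :
    G.Adj v u ↔ T.kind ((T.leaf u : T.tree) ⊓ c) = .join := by
  rw [T.adj_iff v u (by rintro rfl; exact hu hv), inf_comm, RootedTree.inf_eq_inf_of_not_le hv hu]

theorem prod_interior_ge {M : Type*} [CommMonoid M] {w : T.tree} (hw : ¬ IsMax w)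
    (g : T.tree → M) :
    ∏ x ∈ T.interior.filter (w ≤ ·), g x =
      g w * ∏ c ∈ T.children w, ∏ x ∈ T.interior.filter (c ≤ ·), g x := by
  rw [← Finset.prod_biUnion, ← Finset.prod_insert]
  · refine Finset.prod_congr ?_ fun _ _ => rfl
    ext x
    simp only [Finset.mem_filter, Finset.mem_insert, Finset.mem_biUnion, children, interior,
      Finset.mem_univ, true_and]
    constructor
    · rintro ⟨hx, hwx⟩
      rcases hwx.eq_or_lt with h | h
      · exact Or.inl h.symm
      · obtain ⟨c, hc, hcx⟩ := T.exists_child h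
        exact Or.inr ⟨c, hc, hx, hcx⟩
    · rintro (rfl | ⟨c, hc, hx, hcx⟩)
      · exact ⟨hw, le_rfl⟩
      · exact ⟨hx, hc.le.trans hcx⟩
  · simp only [Finset.mem_filter, Finset.mem_biUnion, children, Finset.mem_univ, true_and,
      not_exists, not_and]
    exact fun c hc _ hcw => hc.lt.not_ge hcw
  · intro c hc c' hc' hne
    simp only [children, Finset.coe_filter, Finset.mem_univ, true_and, Set.mem_ofPred_eq] at hc hc'
    refine Finset.disjoint_left.2 fun x hx hx' => hne ?_
    exact RootedTree.eq_of_covBy_of_le hc hc' (Finset.mem_filter.1 hx).2 (Finset.mem_filter.1 hx').2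

variable [Fintype V]

/-- Leaves are sorted by parent; a leaf and its parent have the same meet with an interior `w`. -/
theorem degree_eq_card {w : T.tree} (hw : ¬ IsMax w) :
    T.degree w = (Finset.univ.filter fun u : V =>
      T.kind ((T.leaf u : T.tree) ⊓ w) = .join).card := by
  have hcov : ∀ u, Order.pred (T.leaf u : T.tree) ⋖ T.leaf u := fun u => by
    refine Order.pred_covBy_of_not_isMin fun hmin => T.not_leaf_le hw u ?_
    rw [isMin_iff_eq_bot.1 hmin]
    exact bot_le
  rw [degree, Finset.card_eq_sum_card_fiberwise (f := fun u => Order.pred (T.leaf u : T.tree))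
    (t := T.interior.filter (fun x => T.kind (x ⊓ w) = .join))]
  · refine Finset.sum_congr rfl fun x hx => ?_
    rw [Finset.mem_filter] at hx
    symm
    refine Finset.card_bij (fun u _ => (T.leaf u : T.tree)) ?_ ?_ ?_
    · intro u hu
      simp only [Finset.mem_filter, Finset.mem_univ, true_and] at hu ⊢
      exact ⟨hu.2 ▸ hcov u, (T.leaf u).2⟩
    · intro u _ v _ h
      exact T.leaf.injective (Subtype.ext h)
    · intro y hy
      simp only [Finset.mem_filter, Finset.mem_univ, true_and] at hy
      obtain ⟨u, hu⟩ := T.leaf.surjective ⟨y, hy.2⟩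
      have hu : (T.leaf u : T.tree) = y := by rw [hu]
      refine ⟨u, ?_, hu⟩
      have hp : Order.pred y = x := hy.1.pred_eq
      simp only [Finset.mem_filter, Finset.mem_univ, true_and, hu]
      refine ⟨?_, hp⟩
      have hyw : ¬ y ≤ w := hu ▸ T.not_leaf_le hw u
      rw [inf_comm, RootedTree.inf_eq_inf_of_covBy hy.1 hyw, inf_comm]
      exact hx.2
  · intro u hu
    simp only [Finset.coe_filter, Finset.mem_univ, true_and, Set.mem_ofPred_eq] at hu ⊢
    refine ⟨by simpa [interior] using (hcov u).lt.not_isMax, ?_⟩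
    rw [inf_comm, ← RootedTree.inf_eq_inf_of_covBy (hcov u) (T.not_leaf_le hw u), inf_comm]
    exact hu

/-- Connectedness forces an edge out of the leaves below a child of `w`; its far end is counted by
the degree. -/
theorem degree_pos (hG : G.Connected) {w : T.tree} (hw : ¬ IsMax w) : 0 < T.degree w := by
  obtain ⟨c, c', hne, hc, hc'⟩ := T.two_children w hw
  obtain ⟨v, hv⟩ := T.exists_leaf_ge c
  obtain ⟨v', hv'⟩ := T.exists_leaf_ge c'
  obtain ⟨p⟩ := hG v v'
  obtain ⟨d, -, h1, h2⟩ := p.exists_boundary_dart {u | c ≤ T.leaf u} hv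
    fun h => hne (RootedTree.eq_of_covBy_of_le hc hc' h hv')
  rw [T.degree_eq_card hw, Finset.card_pos]
  refine ⟨d.snd, ?_⟩
  simpa [← RootedTree.inf_eq_inf_of_covBy hc h2] using (T.adj_iff_of_le h1 h2).1 d.adj

/-! ### Laplacian blocks of subtrees -/

/-- The number of leaves below `w`. -/
noncomputable def size (w : T.tree) : ℕ :=
  (Finset.univ.filter fun u : V => w ≤ T.leaf u).card

/-- The number of leaves not below `w` that are adjacent to the leaves below `w`. -/
noncomputable def extDegree (w : T.tree) : ℕ :=
  (Finset.univ.filter fun u : V => ¬ w ≤ T.leaf u ∧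
    T.kind ((T.leaf u : T.tree) ⊓ w) = .join).card

/-- The indicator of the nodes of type join. -/
noncomputable def joinInd (w : T.tree) : ℚ := if T.kind w = .join then 1 else 0

theorem degree_eq {w : T.tree} (hw : ¬ IsMax w) :
    (T.degree w : ℚ) = T.extDegree w + T.joinInd w * T.size w := by
  rw [T.degree_eq_card hw, ← Finset.card_filter_add_card_filter_not (fun u => ¬ w ≤ T.leaf u),
    Finset.filter_filter, Finset.filter_filter, Nat.cast_add, extDegree]
  simp_rw [and_comm (a := ¬ w ≤ _), not_not]
  congr 1
  have : ∀ u : V, (T.kind ((T.leaf u : T.tree) ⊓ w) = .join ∧ w ≤ T.leaf u) ↔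
      (w ≤ T.leaf u ∧ T.kind w = .join) := fun u =>
    ⟨fun h => ⟨h.2, by simpa [inf_eq_right.2 h.2] using h.1⟩,
      fun h => ⟨by simpa [inf_eq_right.2 h.1] using h.2, h.1⟩⟩
  simp_rw [this, joinInd, size]
  split_ifs with h <;> simp [h]

/-- This identifies the factor that the block of `c` contributes when the added constant is `joinInd
w`. -/
theorem degree_eq_of_covBy {w c : T.tree} (hc : w ⋖ c) :
    (T.degree w : ℚ) = T.extDegree c + T.joinInd w * T.size c := by
  rw [T.degree_eq_card hc.lt.not_isMax,
    ← Finset.card_filter_add_card_filter_not (fun u => ¬ c ≤ T.leaf u),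
    Finset.filter_filter, Finset.filter_filter, Nat.cast_add, extDegree]
  simp_rw [not_not]
  congr 1
  · congr 2
    ext u
    simp only [Finset.mem_filter, Finset.mem_univ, true_and]
    rw [and_comm]
    exact and_congr_right fun h => by rw [RootedTree.inf_eq_inf_of_covBy hc h]
  have : ∀ u : V, (T.kind ((T.leaf u : T.tree) ⊓ w) = .join ∧ c ≤ T.leaf u) ↔
      (c ≤ T.leaf u ∧ T.kind w = .join) := fun u =>
    ⟨fun h => ⟨h.2, by simpa [inf_eq_right.2 (hc.le.trans h.2)] using h.1⟩,
      fun h => ⟨by simpa [inf_eq_right.2 (hc.le.trans h.1)] using h.2, h.1⟩⟩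
  simp_rw [this, joinInd, size]
  split_ifs with h <;> simp [h]

/-- Full Laplacian rows sum to zero, and each neighbour outside the block contributes `-1`. -/
theorem sum_lapMatrix_row (w : T.tree) {v : V} (hv : w ≤ T.leaf v) :
    ∑ u : {u // w ≤ T.leaf u}, G.lapMatrix ℚ v u = T.extDegree w := by
  have h0 : ∑ u, G.lapMatrix ℚ v u = 0 := by
    simpa [Matrix.mulVec, dotProduct] using congrFun (G.lapMatrix_mulVec_const_eq_zero (R := ℚ)) v
  rw [← Finset.sum_subtype (Finset.univ.filter fun u => w ≤ T.leaf u) (by simp)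
    (fun u => G.lapMatrix ℚ v u)]
  rw [← Finset.sum_filter_add_sum_filter_not _ (fun u => w ≤ T.leaf u)] at h0
  rw [eq_neg_of_add_eq_zero_left h0, ← Finset.sum_neg_distrib, extDegree, Finset.card_filter,
    Nat.cast_sum, Finset.sum_filter]
  refine Finset.sum_congr rfl fun u _ => ?_
  by_cases hu : w ≤ T.leaf u
  · simp [hu]
  · have hne : v ≠ u := by rintro rfl; exact hu hv
    simp [hu, SimpleGraph.lapMatrix, SimpleGraph.degMatrix, hne, T.adj_iff_of_le hv hu,
      SimpleGraph.adjMatrix_apply]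

/-- The constant `y` stays free because the induction uses the children's blocks with the constant
set by the type of their parent. -/
theorem det_lapMatrix_submatrix_add_const (hG : G.Connected) (w : T.tree) (y : ℚ) :
    ((G.lapMatrix ℚ).submatrix Subtype.val Subtype.val + Matrix.of fun _ _ => y :
      Matrix {v // w ≤ T.leaf v} {v // w ≤ T.leaf v} ℚ).det =
    (T.extDegree w + y * T.size w) *
      ∏ x ∈ T.interior.filter (w ≤ ·), (T.degree x : ℚ) ^ (T.s x + T.t x - 1) := by
  induction w using WellFoundedGT.induction generalizing y with
  | _ w ih =>
  by_cases hw : IsMax w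
  · obtain ⟨v, hv⟩ := T.leaf.surjective ⟨w, hw⟩
    have hv : (T.leaf v : T.tree) = w := by rw [hv]
    have huniq : ∀ u : V, w ≤ T.leaf u ↔ u = v := fun u =>
      ⟨fun h => T.leaf.injective (Subtype.ext ((hw.eq_of_le h).symm.trans hv.symm)),
        fun h => by rw [h, hv]⟩
    let : Unique {u // w ≤ T.leaf u} := ⟨⟨⟨v, hv.ge⟩⟩, fun u => Subtype.ext ((huniq u).1 u.2)⟩
    have hsum := T.sum_lapMatrix_row w hv.ge
    rw [Fintype.sum_unique] at hsum
    have hempty : T.interior.filter (w ≤ ·) = ∅ := by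
      refine Finset.filter_eq_empty_iff.2 fun x hx hwx => ?_
      exact (Finset.mem_filter.1 hx).2 (hw.eq_of_le hwx ▸ hw)
    have hsize : T.size w = 1 := by
      rw [size]; exact Finset.card_eq_one.2 ⟨v, by ext u; simp [huniq]⟩
    rw [Matrix.det_unique, hempty, hsize, ← hsum]
    simp
    rfl
  · set a := T.joinInd w with ha
    set N : Matrix {v // w ≤ T.leaf v} {v // w ≤ T.leaf v} ℚ :=
      (G.lapMatrix ℚ).submatrix Subtype.val Subtype.val + Matrix.of fun _ _ => a with hN
    have hδ : (T.degree w : ℚ) ≠ 0 := by exact_mod_cast (T.degree_pos hG hw).ne'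
    have hcard : Fintype.card {v // w ≤ T.leaf v} = T.size w := Fintype.card_subtype _
    have hrow : ∀ i, ∑ j, N i j = T.degree w := by
      intro i
      rw [T.degree_eq hw, ← T.sum_lapMatrix_row w i.2, ← hcard]
      simp [hN, Finset.sum_add_distrib, mul_comm, ha]
    choose child hchild hle using fun v : {v // w ≤ T.leaf v} =>
      T.exists_child (T.lt_leaf hw v.2)
    have hchild_iff : ∀ i c, w ⋖ c → (child i = c ↔ c ≤ T.leaf i) := fun i c hc =>
      ⟨fun h => h ▸ hle i, fun h => RootedTree.eq_of_covBy_of_le (hchild i) hc (hle i) h⟩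
    have hzero : ∀ i j, child i ≠ child j → N i j = 0 := by
      intro i j hij
      have hij' : ¬ child i ≤ T.leaf j := fun h => hij ((hchild_iff j _ (hchild i)).2 h).symm
      have hne : (i : V) ≠ j := by rintro h; exact hij (by rw [Subtype.ext h])
      have hadj := T.adj_iff_of_le (hle i) hij'
      rw [RootedTree.inf_eq_inf_of_covBy (hchild i) hij', inf_eq_right.2 j.2] at hadj
      simp [hN, ha, joinInd, SimpleGraph.lapMatrix, SimpleGraph.degMatrix, hne,
        SimpleGraph.adjMatrix_apply, hadj]
    have himage : Finset.univ.image child = T.children w := by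
      ext c
      simp only [Finset.mem_image, Finset.mem_univ, true_and, children, Finset.mem_filter]
      constructor
      · rintro ⟨i, rfl⟩; exact hchild i
      · intro hc
        obtain ⟨v, hv⟩ := T.exists_leaf_ge c
        exact ⟨⟨v, hc.le.trans hv⟩, (hchild_iff _ c hc).2 hv⟩
    have hdetN : N.det = (T.degree w : ℚ) ^ (T.children w).card * ∏ c ∈ T.children w,
        ∏ x ∈ T.interior.filter (c ≤ ·), (T.degree x : ℚ) ^ (T.s x + T.t x - 1) := by
      rw [N.det_eq_prod_toSquareBlock child hzero, himage, ← Finset.prod_const,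
        ← Finset.prod_mul_distrib]
      refine Finset.prod_congr rfl fun c hc => ?_
      have hc : w ⋖ c := (Finset.mem_filter.1 hc).2
      rw [T.degree_eq_of_covBy hc, ← ih c hc.lt]
      let e : {v // c ≤ T.leaf v} ≃ {i // child i = c} :=
        { toFun := fun v => ⟨⟨v, hc.le.trans v.2⟩, (hchild_iff _ c hc).2 v.2⟩
          invFun := fun i => ⟨i, (hchild_iff _ c hc).1 i.2⟩
          left_inv := fun _ => rfl
          right_inv := fun _ => rfl }
      rw [← Matrix.det_submatrix_equiv_self e]
      rfl
    have hsplit : ((G.lapMatrix ℚ).submatrix Subtype.val Subtype.val + Matrix.of fun _ _ => y :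
        Matrix {v // w ≤ T.leaf v} {v // w ≤ T.leaf v} ℚ) =
        N + Matrix.of fun _ _ => (y - a) := by
      ext i j
      simp [hN]
    have hmain := N.det_add_const hδ hrow (y - a)
    refine mul_right_cancel₀ hδ ?_
    -- A child exists, so the exponent `s + t - 1` is not truncated.
    obtain ⟨k, hk⟩ := Nat.exists_eq_add_of_le' (one_le_two.trans (T.two_le_card_children hw))
    rw [hsplit, hmain, hdetN, T.prod_interior_ge hw, ← T.card_children, hk, Nat.add_sub_cancel,
      hcard]
    have hd := T.degree_eq hw
    rw [show (T.degree w : ℚ) + (y - a) * T.size w = T.extDegree w + y * T.size w by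
      rw [hd]; ring]
    ring

end Cotree

/-! ### Evaluation at the root -/

open Classical in
theorem theorem4p1 {V : Type*} [Fintype V] (G : SimpleGraph V) (n : ℕ)
    (hn : Fintype.card V = n) (hn2 : 2 ≤ n)
    (hconn : G.Connected) (hco : G.IsCograph) (T : Cotree G) :
    G.numSpanningTrees =
      (∏ w ∈ T.interior.erase T.root, T.degree w ^ (T.s w + T.t w - 1)) *
        n ^ (T.s T.root + T.t T.root - 2) := by
  have hroot : ¬ IsMax T.root := by
    intro h
    obtain ⟨u, v, huv⟩ := Fintype.one_lt_card_iff.1 (hn ▸ hn2 : 1 < Fintype.card V)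
    have key : ∀ v, T.root = T.leaf v := fun v => h.eq_of_le bot_le
    exact huv (T.leaf.injective (Subtype.ext ((key u).symm.trans (key v))))
  have hall : ∀ x : T.tree, T.root ≤ x := fun x => bot_le
  have hdeg : T.degree T.root = n := by
    have hpos := T.degree_pos hconn hroot
    have hinf : ∀ x : T.tree, x ⊓ T.root = T.root := fun x => inf_eq_right.2 (hall x)
    rw [T.degree_eq_card hroot] at hpos ⊢
    simp only [hinf] at hpos ⊢
    -- Every meet with the root is the root, so the degree is `n` or `0`; positivity excludes `0`.
    by_cases h : T.kind T.root = .join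
    · simp [h, hn]
    · simp [h] at hpos
  have hsize : T.size T.root = n := by simp [Cotree.size, hall, hn]
  have hext : T.extDegree T.root = 0 := by simp [Cotree.extDegree, hall]
  have hdet := T.det_lapMatrix_submatrix_add_const hconn T.root 1
  have : Nonempty V := hconn.nonempty
  have hL := G.det_lapMatrix_add_one ℚ
  rw [← Matrix.det_submatrix_equiv_self (Equiv.subtypeUnivEquiv fun v => hall (T.leaf v))] at hL
  have hL' := hL.symm.trans hdet
  have hmem : T.root ∈ T.interior := by simpa [Cotree.interior] using hroot
  rw [Finset.filter_true_of_mem fun x _ => hall x, hsize, hext, hn,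
    ← Finset.mul_prod_erase _ _ hmem, hdeg] at hL'
  -- Two children at the root make `s + t - 2` a true subtraction, so `n²` cancels.
  obtain ⟨k, hk⟩ := Nat.exists_eq_add_of_le' (T.two_le_card_children hroot)
  rw [T.card_children] at hk
  rw [hk] at hL' ⊢
  have hn0 : (n : ℚ) ^ 2 ≠ 0 := by positivity
  have : (G.numSpanningTrees : ℚ) =
      (∏ w ∈ T.interior.erase T.root, (T.degree w : ℚ) ^ (T.s w + T.t w - 1)) * n ^ k := by
    refine mul_left_cancel₀ hn0 (hL'.trans ?_)
    rw [show k + 2 - 1 = k + 1 from rfl]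
    push_cast
    ring
  rw [Nat.add_sub_cancel]
  exact_mod_cast this
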